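/- An algebraic circuit over a field $\mathbb F$ is a finite sequence of gates, each of which is a constant of $\mathbb F$, an input variable, an $\mathbb F$-linear combination of earlier gates, or a product of earlier gates (of any fan-in, possibly with repeated factors); its size is its number of gates plus its number of wires, and it computes a polynomial if that formal polynomial is computed at one of its gates. Let $F_1,\dots,F_m\in\mathbb F[x_1,\dots,x_n]$. An IPS certificate of the unsatisfiability of the system $F_1=\dots=F_m=0$ is a polynomial $C(\vec x,\vec f)\in\mathbb F[x_1,\dots,x_n,f_1,\dots,f_m]$, in the variables $\vec x$ and in placeholder variables $f_1,\dots,f_m$, such that $C(\vec x,\vec 0)=0$ and $C(\vec x,F_1(\vec x),\dots,F_m(\vec x))=1$. It is Hilbert-like if it has the form $\sum_{i=1}^m f_i\,G_i(\vec x)$ with $G_i\in\mathbb F[x_1,\dots,x_n]$. There is a polynomial $P$ in four variables with coefficients in $\mathbb N$ such that, for every field $\mathbb F$, all $n,m\in\mathbb N$ and all $F_1,\dots,F_m\in\mathbb F[x_1,\dots,x_n]$, the following holds. Let $C(\vec x,\vec f)$ be an IPS certificate of the unsatisfiability of $F_1=\dots=F_m=0$, let $D=\max_i\deg_{f_i}C$,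 and let $t$ be the number of terms of $C$ viewed as a polynomial in the $f_i$ with coefficients in $\mathbb F[\vec x]$. Suppose that $C$ and each $F_i$ can be computed by circuits over $\mathbb F$ of size at most $s$. Then some Hilbert-like IPS certificate of the unsatisfiability of $F_1=\dots=F_m=0$ can be computed by a circuit over $\mathbb F$ of size at most $P(D,t,n,s)$. -/

import Mathlib

/-! Algebraic circuits and Ideal Proof System (IPS) certificates. -/

namespace IPS

/-- A gate of an algebraic circuit over `F` with input variables indexed by `σ`, all of whose
wires come from `k` earlier gates: a constant, an input variable, a linear combination, or a
product. Linear combination and product gates may have any fan-in (in particular fan-in two),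
and a wire may be repeated. -/
inductive Gate (F σ : Type*) (k : ℕ) where
  | const (a : F) : Gate F σ k
  | var (i : σ) : Gate F σ k
  | lin (l : List (F × Fin k)) : Gate F σ k
  | mul (l : List (Fin k)) : Gate F σ k

/-- The number of wires entering a gate. -/
def Gate.fanIn {F σ : Type*} {k : ℕ} : Gate F σ k → ℕ
  | .const _ => 0
  | .var _ => 0
  | .lin l => l.length
  | .mul l => l.length

/-- The polynomial computed at a gate, given the polynomials computed at the earlier gates. -/
noncomputable def Gate.eval {F σ : Type*} [CommSemiring F] {k : ℕ}
    (v : Fin k → MvPolynomial σ F) : Gate F σ k → MvPolynomial σ F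
  | .const a => MvPolynomial.C a
  | .var i => MvPolynomial.X i
  | .lin l => (l.map fun p => MvPolynomial.C p.1 * v p.2).sum
  | .mul l => (l.map v).prod

/-- An algebraic circuit (straight-line program) with `k` gates: a sequence of gates in which the
wires into each gate come from earlier gates. -/
inductive Circuit (F σ : Type*) : ℕ → Type _ where
  | nil : Circuit F σ 0
  | snoc {k : ℕ} (c : Circuit F σ k) (g : Gate F σ k) : Circuit F σ (k + 1)

/-- The polynomials computed at the gates of a circuit. -/
noncomputable def Circuit.eval {F σ : Type*} [CommSemiring F] :
    {k : ℕ} → Circuit F σ k → Fin k → MvPolynomial σ F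
  | _, .nil => Fin.elim0
  | _, .snoc c g => Fin.snoc (α := fun _ => MvPolynomial σ F) c.eval (g.eval c.eval)

/-- The size of a circuit: its number of gates (inputs and constants included) plus its number
of wires. -/
def Circuit.size {F σ : Type*} : {k : ℕ} → Circuit F σ k → ℕ
  | _, .nil => 0
  | _, .snoc c g => c.size + (1 + g.fanIn)

/-- The polynomial `p` is computed at some gate of a circuit of size at most `s`. -/
def HasCircuit {F σ : Type*} [CommSemiring F] (p : MvPolynomial σ F) (s : ℕ) : Prop :=
  ∃ (k : ℕ) (c : Circuit F σ k) (o : Fin k), c.eval o = p ∧ c.size ≤ s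

/-- `C(x, f)` is an IPS certificate of the unsatisfiability of `F₁(x) = ⋯ = Fₘ(x) = 0`. In
`Fin n ⊕ Fin m` the left summand indexes the variables `x` and the right one the
placeholders `f`. -/
structure IsCertificate {F : Type*} [CommSemiring F] {n m : ℕ}
    (Fs : Fin m → MvPolynomial (Fin n) F) (C : MvPolynomial (Fin n ⊕ Fin m) F) : Prop where
  /-- `C(x, 0) = 0`. -/
  subst_zero : MvPolynomial.aeval
    (Sum.elim MvPolynomial.X (fun _ => 0) : Fin n ⊕ Fin m → MvPolynomial (Fin n) F) C = 0
  /-- `C(x, F(x)) = 1`. -/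
  subst_system : MvPolynomial.aeval
    (Sum.elim MvPolynomial.X Fs : Fin n ⊕ Fin m → MvPolynomial (Fin n) F) C = 1

/-- `C` has the form `∑ᵢ fᵢ Gᵢ(x)`. -/
def IsHilbertLike {F : Type*} [CommSemiring F] {n m : ℕ}
    (C : MvPolynomial (Fin n ⊕ Fin m) F) : Prop :=
  ∃ G : Fin m → MvPolynomial (Fin n) F,
    C = ∑ i, MvPolynomial.X (Sum.inr i) * MvPolynomial.rename Sum.inl (G i)

/-- `C(x, f)` viewed as a polynomial in the placeholders `f` with coefficients in `F[x]`. -/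
noncomputable def inPlaceholders {F : Type*} [CommSemiring F] {n m : ℕ} :
    MvPolynomial (Fin n ⊕ Fin m) F →ₐ[F] MvPolynomial (Fin m) (MvPolynomial (Fin n) F) :=
  MvPolynomial.aeval
    (Sum.elim (fun j => MvPolynomial.C (MvPolynomial.X j)) MvPolynomial.X)

/-- The number of terms of `C`, viewed as a polynomial in the placeholders with coefficients
in `F[x]`. -/
noncomputable def numTerms {F : Type*} [CommSemiring F] {n m : ℕ}
    (C : MvPolynomial (Fin n ⊕ Fin m) F) : ℕ :=
  (inPlaceholders C).support.card

/-- The maximum over the placeholders `fᵢ` of the degree of `C` in `fᵢ`. -/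
noncomputable def maxDegree {F : Type*} [CommSemiring F] {n m : ℕ}
    (C : MvPolynomial (Fin n ⊕ Fin m) F) : ℕ :=
  Finset.univ.sup fun i : Fin m => C.degreeOf (Sum.inr i)

end IPS

namespace IPS

/-! Every polynomial `p(x, f)` computed by a circuit can be replaced by a Hilbert-like `H` that
agrees at `f = F(x)` with the difference `p(x, F(x)) - p(x, 0)`. For a certificate this difference
is `1 - 0`, so its `H` is again a certificate.

`H` is built gate by gate. It is `0` for constants and variables of `x`, `fᵢ` for a placeholder,
linear at linear gates, and at products follows a discrete Leibniz rule (`IsLinearization.mul`):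
`p(F) q(F) - p(0) q(0) = q(F) (p(F) - p(0)) + p(0) (q(F) - q(0))`. The multipliers `q(F)` and `p(0)`
involve only `x`, so `H` stays linear in `f`. A single circuit carries `p(F)`, `p(0)` and `H` for
all gates at once, so that earlier values are shared and each new gate adds a bounded cost per wire.
-/

open MvPolynomial

/-! ### Circuits computing sets of polynomials -/

section Computable

variable {F σ τ : Type*} [CommSemiring F]

/-- All polynomials of the set `S` are computed at gates of one circuit of size at most `s`. -/
def JointlyComputable (S : Set (MvPolynomial σ F)) (s : ℕ) : Prop :=
  ∃ (k : ℕ) (c : Circuit F σ k), S ⊆ Set.range c.eval ∧ c.size ≤ s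

theorem jointlyComputable_empty : JointlyComputable (∅ : Set (MvPolynomial σ F)) 0 :=
  ⟨0, .nil, Set.empty_subset _, le_rfl⟩

theorem JointlyComputable.mono {S T : Set (MvPolynomial σ F)} {s t : ℕ}
    (h : JointlyComputable S s) (hT : T ⊆ S) (hs : s ≤ t) : JointlyComputable T t := by
  obtain ⟨k, c, hc, hcs⟩ := h
  exact ⟨k, c, hT.trans hc, hcs.trans hs⟩

theorem JointlyComputable.hasCircuit {S : Set (MvPolynomial σ F)} {s : ℕ}
    {p : MvPolynomial σ F} (h : JointlyComputable S s) (hp : p ∈ S) : HasCircuit p s := by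
  obtain ⟨k, c, hc, hcs⟩ := h
  obtain ⟨o, ho⟩ := hc hp
  exact ⟨k, c, o, ho, hcs⟩

theorem Circuit.range_eval_snoc {k : ℕ} (c : Circuit F σ k) (g : Gate F σ k) :
    Set.range (c.snoc g).eval = insert (g.eval c.eval) (Set.range c.eval) := by
  ext p
  simp only [Set.mem_range, Set.mem_insert_iff, Circuit.eval]
  rw [Fin.exists_fin_succ']
  simp only [Fin.snoc_castSucc, Fin.snoc_last]
  rw [or_comm, eq_comm]

theorem JointlyComputable.insert_const {S : Set (MvPolynomial σ F)} {s : ℕ}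
    (h : JointlyComputable S s) (a : F) : JointlyComputable (insert (C a) S) (s + 1) := by
  obtain ⟨k, c, hc, hcs⟩ := h
  refine ⟨k + 1, c.snoc (.const a), ?_, ?_⟩
  · rw [Circuit.range_eval_snoc]
    exact Set.insert_subset_insert hc
  · simp only [Circuit.size, Gate.fanIn]
    omega

theorem JointlyComputable.insert_var {S : Set (MvPolynomial σ F)} {s : ℕ}
    (h : JointlyComputable S s) (i : σ) : JointlyComputable (insert (X i) S) (s + 1) := by
  obtain ⟨k, c, hc, hcs⟩ := h
  refine ⟨k + 1, c.snoc (.var i), ?_, ?_⟩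
  · rw [Circuit.range_eval_snoc]
    exact Set.insert_subset_insert hc
  · simp only [Circuit.size, Gate.fanIn]
    omega

/-- An arbitrary index type `ι` frees callers from gate positions: a gate for each `v i` is chosen
inside the proof. -/
theorem JointlyComputable.insert_lin {S : Set (MvPolynomial σ F)} {s : ℕ}
    (h : JointlyComputable S s) {ι : Type*} (l : List (F × ι)) (v : ι → MvPolynomial σ F)
    (hv : ∀ i, v i ∈ S) :
    JointlyComputable (insert (l.map fun p => C p.1 * v p.2).sum S) (s + (1 + l.length)) := by
  obtain ⟨k, c, hc, hcs⟩ := h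
  choose w hw using fun i => hc (hv i)
  refine ⟨k + 1, c.snoc (.lin (l.map fun p => (p.1, w p.2))), ?_, ?_⟩
  · rw [Circuit.range_eval_snoc]
    simpa only [Gate.eval, List.map_map, Function.comp_def, hw] using Set.insert_subset_insert hc
  · simp only [Circuit.size, Gate.fanIn, List.length_map]
    omega

theorem JointlyComputable.insert_prod {S : Set (MvPolynomial σ F)} {s : ℕ}
    (h : JointlyComputable S s) {ι : Type*} (l : List ι) (v : ι → MvPolynomial σ F)
    (hv : ∀ i, v i ∈ S) :
    JointlyComputable (insert (l.map v).prod S) (s + (1 + l.length)) := by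
  obtain ⟨k, c, hc, hcs⟩ := h
  choose w hw using fun i => hc (hv i)
  refine ⟨k + 1, c.snoc (.mul (l.map w)), ?_, ?_⟩
  · rw [Circuit.range_eval_snoc]
    simpa only [Gate.eval, List.map_map, Function.comp_def, hw] using Set.insert_subset_insert hc
  · simp only [Circuit.size, Gate.fanIn, List.length_map]
    omega

theorem JointlyComputable.insert_add {S : Set (MvPolynomial σ F)} {s : ℕ}
    (h : JointlyComputable S s) {p q : MvPolynomial σ F} (hp : p ∈ S) (hq : q ∈ S) :
    JointlyComputable (insert (p + q) S) (s + 3) := by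
  have := h.insert_lin [(1, (⟨p, hp⟩ : S)), (1, ⟨q, hq⟩)] Subtype.val Subtype.property
  simpa using this

theorem JointlyComputable.insert_mul {S : Set (MvPolynomial σ F)} {s : ℕ}
    (h : JointlyComputable S s) {p q : MvPolynomial σ F} (hp : p ∈ S) (hq : q ∈ S) :
    JointlyComputable (insert (p * q) S) (s + 3) := by
  have := h.insert_prod [(⟨p, hp⟩ : S), ⟨q, hq⟩] Subtype.val Subtype.property
  simpa using this

/-- Running a circuit, with its variables renamed, after another one. -/
theorem JointlyComputable.union_rename_circuit {S : Set (MvPolynomial τ F)} {s : ℕ}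
    (h : JointlyComputable S s) (e : σ → τ) {k : ℕ} (c : Circuit F σ k) :
    JointlyComputable (S ∪ Set.range fun o => rename e (c.eval o)) (s + c.size) := by
  induction c with
  | nil => exact h.mono (by simp [Set.range_eq_empty]) le_rfl
  | @snoc k c g ih =>
    suffices hg : JointlyComputable (insert (rename e (g.eval c.eval))
        (S ∪ Set.range fun o => rename e (c.eval o))) (s + c.size + (1 + g.fanIn)) by
      refine hg.mono ?_ (by simp only [Circuit.size]; omega)
      rintro p (hp | ⟨o, rfl⟩)
      · exact .inr (.inl hp)
      · induction o using Fin.lastCases with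
        | last => left; simp [Circuit.eval]
        | cast o => right; right; exact ⟨o, by simp [Circuit.eval]⟩
    have hmem : ∀ o, rename e (c.eval o) ∈ S ∪ Set.range fun o => rename e (c.eval o) :=
      fun o => .inr ⟨o, rfl⟩
    cases g with
    | const a => simpa [Gate.eval, Gate.fanIn] using ih.insert_const a
    | var i => simpa [Gate.eval, Gate.fanIn] using ih.insert_var (e i)
    | lin l =>
      simpa [Gate.eval, Gate.fanIn, map_list_sum, Function.comp_def] using ih.insert_lin l _ hmem
    | mul l =>
      simpa [Gate.eval, Gate.fanIn, map_list_prod, Function.comp_def] using ih.insert_prod l _ hmem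

/-- With `e = Sum.inl` this brings a circuit for `Fᵢ(x)` into one over both `x` and `f`. -/
theorem JointlyComputable.insert_rename {S : Set (MvPolynomial τ F)} {s t : ℕ}
    (h : JointlyComputable S s) (e : σ → τ) {p : MvPolynomial σ F} (hp : HasCircuit p t) :
    JointlyComputable (insert (rename e p) S) (s + t) := by
  obtain ⟨k, c, o, rfl, hc⟩ := hp
  refine (h.union_rename_circuit e c).mono ?_ (by omega)
  exact Set.insert_subset (.inr ⟨o, rfl⟩) Set.subset_union_left

end Computable

/-! ### Hilbert-like polynomials and substitution for the placeholders -/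

section HilbertLike

variable {F : Type*} [CommSemiring F] {n m : ℕ}

theorem isHilbertLike_zero : IsHilbertLike (0 : MvPolynomial (Fin n ⊕ Fin m) F) :=
  ⟨0, by simp⟩

theorem isHilbertLike_X (i : Fin m) :
    IsHilbertLike (X (Sum.inr i) : MvPolynomial (Fin n ⊕ Fin m) F) :=
  ⟨Pi.single i 1, by
    rw [Finset.sum_eq_single i]
    · simp
    · intro j _ hj
      simp [Pi.single_eq_of_ne hj]
    · simp⟩

theorem IsHilbertLike.add {p q : MvPolynomial (Fin n ⊕ Fin m) F} (hp : IsHilbertLike p)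
    (hq : IsHilbertLike q) : IsHilbertLike (p + q) := by
  obtain ⟨G, rfl⟩ := hp
  obtain ⟨H, rfl⟩ := hq
  exact ⟨G + H, by simp [mul_add, Finset.sum_add_distrib]⟩

theorem IsHilbertLike.rename_mul {p : MvPolynomial (Fin n ⊕ Fin m) F} (hp : IsHilbertLike p)
    (a : MvPolynomial (Fin n) F) : IsHilbertLike (rename Sum.inl a * p) := by
  obtain ⟨G, rfl⟩ := hp
  exact ⟨fun i => a * G i, by simp [Finset.mul_sum, mul_left_comm]⟩

theorem IsHilbertLike.C_mul {p : MvPolynomial (Fin n ⊕ Fin m) F} (hp : IsHilbertLike p)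
    (a : F) : IsHilbertLike (C a * p) := by
  simpa using hp.rename_mul (C a)

theorem IsHilbertLike.list_sum {l : List (MvPolynomial (Fin n ⊕ Fin m) F)}
    (h : ∀ p ∈ l, IsHilbertLike p) : IsHilbertLike l.sum := by
  induction l with
  | nil => exact isHilbertLike_zero
  | cons p l ih =>
    rw [List.sum_cons]
    exact (h p (by simp)).add (ih fun q hq => h q (by simp [hq]))

/-- The substitution of the polynomials `Fs` for the placeholders. -/
noncomputable def substPlaceholders (Fs : Fin m → MvPolynomial (Fin n) F) :
    MvPolynomial (Fin n ⊕ Fin m) F →ₐ[F] MvPolynomial (Fin n) F :=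
  aeval (Sum.elim X Fs)

@[simp]
theorem substPlaceholders_X_inl (Fs : Fin m → MvPolynomial (Fin n) F) (j : Fin n) :
    substPlaceholders Fs (X (Sum.inl j)) = X j := by
  simp [substPlaceholders]

@[simp]
theorem substPlaceholders_X_inr (Fs : Fin m → MvPolynomial (Fin n) F) (i : Fin m) :
    substPlaceholders Fs (X (Sum.inr i)) = Fs i := by
  simp [substPlaceholders]

@[simp]
theorem substPlaceholders_C (Fs : Fin m → MvPolynomial (Fin n) F) (a : F) :
    substPlaceholders Fs (C a) = C a := by
  simp [substPlaceholders, algebraMap_eq]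

@[simp]
theorem substPlaceholders_rename (Fs : Fin m → MvPolynomial (Fin n) F)
    (p : MvPolynomial (Fin n) F) : substPlaceholders Fs (rename Sum.inl p) = p := by
  rw [substPlaceholders, aeval_rename, Sum.elim_comp_inl, aeval_X_left_apply]

theorem IsHilbertLike.substPlaceholders_zero {p : MvPolynomial (Fin n ⊕ Fin m) F}
    (hp : IsHilbertLike p) : substPlaceholders 0 p = 0 := by
  obtain ⟨G, rfl⟩ := hp
  simp

end HilbertLike

/-! ### Linearizing a circuit gate by gate -/

section Linearization

variable {F : Type*} [CommRing F] {n m : ℕ}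

/-- `H` is a Hilbert-like polynomial which takes the value `p(x, F(x)) - p(x, 0)` at
`f = F(x)`. -/
structure IsLinearization (Fs : Fin m → MvPolynomial (Fin n) F)
    (p H : MvPolynomial (Fin n ⊕ Fin m) F) : Prop where
  isHilbertLike : IsHilbertLike H
  subst_eq : substPlaceholders Fs H = substPlaceholders Fs p - substPlaceholders 0 p

/-- The polynomials `p(x, F(x))`, `p(x, 0)` and `H`. -/
noncomputable def linearizationData (Fs : Fin m → MvPolynomial (Fin n) F)
    (p H : MvPolynomial (Fin n ⊕ Fin m) F) : Set (MvPolynomial (Fin n ⊕ Fin m) F) :=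
  {rename Sum.inl (substPlaceholders Fs p), rename Sum.inl (substPlaceholders 0 p), H}

variable {Fs : Fin m → MvPolynomial (Fin n) F}

/-- The discrete Leibniz rule. Evaluating one factor at `F` and the other at `0` makes the cross
terms `p(0) q(F)` cancel. -/
theorem IsLinearization.mul {p q H K : MvPolynomial (Fin n ⊕ Fin m) F}
    (hp : IsLinearization Fs p H) (hq : IsLinearization Fs q K) :
    IsLinearization Fs (p * q)
      (rename Sum.inl (substPlaceholders Fs q) * H +
        rename Sum.inl (substPlaceholders 0 p) * K) where
  isHilbertLike := (hp.isHilbertLike.rename_mul _).add (hq.isHilbertLike.rename_mul _)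
  subst_eq := by
    simp only [map_add, map_mul, substPlaceholders_rename, hp.subst_eq, hq.subst_eq]
    ring

theorem IsLinearization.list_sum {ι : Type*} {v H : ι → MvPolynomial (Fin n ⊕ Fin m) F}
    (h : ∀ i, IsLinearization Fs (v i) (H i)) (l : List (F × ι)) :
    IsLinearization Fs (l.map fun p => C p.1 * v p.2).sum
      (l.map fun p => C p.1 * H p.2).sum where
  isHilbertLike := by
    refine IsHilbertLike.list_sum fun p hp => ?_
    obtain ⟨a, -, rfl⟩ := List.mem_map.1 hp
    exact (h a.2).isHilbertLike.C_mul a.1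
  subst_eq := by
    induction l with
    | nil => simp
    | cons a l ih =>
      simp only [List.map_cons, List.sum_cons, map_add, map_mul, ih, (h a.2).subst_eq,
        substPlaceholders_C]
      ring

/-- The binary Leibniz rule is folded along the list, so the cost is linear in the fan-in. -/
theorem exists_isLinearization_list_prod {S : Set (MvPolynomial (Fin n ⊕ Fin m) F)} {s : ℕ}
    (hS : JointlyComputable S s) {ι : Type*} {v H : ι → MvPolynomial (Fin n ⊕ Fin m) F}
    (h : ∀ i, IsLinearization Fs (v i) (H i)) (hv : ∀ i, linearizationData Fs (v i) (H i) ⊆ S)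
    (l : List ι) :
    ∃ K, IsLinearization Fs (l.map v).prod K ∧
      JointlyComputable (linearizationData Fs (l.map v).prod K ∪ S) (s + (3 + 15 * l.length)) := by
  induction l with
  | nil =>
    -- The empty product is `1` under both substitutions, so the difference is `0`.
    refine ⟨0, ⟨isHilbertLike_zero, by simp⟩, ?_⟩
    refine ((hS.insert_const 1).insert_const 0).mono ?_ (by simp)
    rintro p ((rfl | rfl | rfl) | hp) <;> simp_all
  | cons i l ih =>
    obtain ⟨K, hK, hc⟩ := ih
    refine ⟨_, (h i).mul hK, ?_⟩
    have hiA : rename Sum.inl (substPlaceholders Fs (v i)) ∈ S := hv i (.inl rfl)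
    have hiB : rename Sum.inl (substPlaceholders 0 (v i)) ∈ S := hv i (.inr (.inl rfl))
    have hiH : H i ∈ S := hv i (.inr (.inr rfl))
    set T := linearizationData Fs (l.map v).prod K ∪ S with hT
    have hA : rename Sum.inl (substPlaceholders Fs (l.map v).prod) ∈ T := .inl (.inl rfl)
    have hB : rename Sum.inl (substPlaceholders 0 (l.map v).prod) ∈ T := .inl (.inr (.inl rfl))
    have hH : K ∈ T := .inl (.inr (.inr rfl))
    have hST : S ⊆ T := Set.subset_union_right
    -- Five binary gates of size 3 each, whence the 15: the products at `F` and at `0`, the two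
    -- Leibniz terms, and their sum.
    have h₁ := hc.insert_mul (hST hiA) hA
    have h₂ := h₁.insert_mul (.inr (hST hiB)) (.inr hB)
    have h₃ := h₂.insert_mul (.inr (.inr hA)) (.inr (.inr (hST hiH)))
    have h₄ := h₃.insert_mul (.inr (.inr (.inr (hST hiB)))) (.inr (.inr (.inr hH)))
    have h₅ := h₄.insert_add (.inr (.inl rfl)) (.inl rfl)
    refine h₅.mono ?_ (by simp only [List.length_cons]; omega)
    simp only [linearizationData, List.map_cons, List.prod_cons, map_mul]
    rintro p ((rfl | rfl | rfl) | hp)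
    · exact .inr (.inr (.inr (.inr (.inl rfl))))
    · exact .inr (.inr (.inr (.inl rfl)))
    · exact .inl rfl
    · exact .inr (.inr (.inr (.inr (.inr (hST hp)))))

/-- The factor `1 + g.fanIn` is what `g` adds to the circuit size, so these costs sum to `(t + 15) *
c.size`. The `t` pays for a copy of the circuit of `Fᵢ` at each placeholder gate. -/
theorem Gate.exists_isLinearization {t : ℕ} (hFs : ∀ i, HasCircuit (Fs i) t)
    {S : Set (MvPolynomial (Fin n ⊕ Fin m) F)} {s k : ℕ} (hS : JointlyComputable S s)
    {v H : Fin k → MvPolynomial (Fin n ⊕ Fin m) F} (h : ∀ o, IsLinearization Fs (v o) (H o))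
    (hv : ∀ o, linearizationData Fs (v o) (H o) ⊆ S) (g : Gate F (Fin n ⊕ Fin m) k) :
    ∃ K, IsLinearization Fs (g.eval v) K ∧
      JointlyComputable (linearizationData Fs (g.eval v) K ∪ S)
        (s + (t + 15) * (1 + g.fanIn)) := by
  cases g with
  | const a =>
    refine ⟨0, ⟨isHilbertLike_zero, by simp [Gate.eval]⟩, ?_⟩
    refine ((hS.insert_const a).insert_const 0).mono ?_ (by simp only [Gate.fanIn]; omega)
    rintro p ((rfl | rfl | rfl) | hp) <;> simp_all [Gate.eval]
  | var i =>
    cases i with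
    | inl j =>
      refine ⟨0, ⟨isHilbertLike_zero, by simp [Gate.eval]⟩, ?_⟩
      refine ((hS.insert_var (.inl j)).insert_const 0).mono ?_ (by simp only [Gate.fanIn]; omega)
      rintro p ((rfl | rfl | rfl) | hp) <;> simp_all [Gate.eval]
    | inr i =>
      refine ⟨X (.inr i), ⟨isHilbertLike_X i, by simp [Gate.eval]⟩, ?_⟩
      refine (((hS.insert_rename Sum.inl (hFs i)).insert_var (.inr i)).insert_const 0).mono ?_
        (by simp only [Gate.fanIn]; omega)
      rintro p ((rfl | rfl | rfl) | hp) <;> simp_all [Gate.eval]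
  | lin l =>
    refine ⟨_, IsLinearization.list_sum h l, ?_⟩
    -- The same linear gate is applied to the values at `F`, to those at `0`, and to the `H o`.
    have h₁ := hS.insert_lin l _ fun o => hv o (.inl rfl)
    have h₂ := h₁.insert_lin l _ fun o => .inr (hv o (.inr (.inl rfl)))
    have h₃ := h₂.insert_lin l _ fun o => .inr (.inr (hv o (.inr (.inr rfl))))
    refine h₃.mono ?_ (by simp only [Gate.fanIn]; nlinarith [Nat.zero_le (t * (1 + l.length))])
    rintro p ((rfl | rfl | rfl) | hp)
    · right; right; left
      simp [Gate.eval, map_list_sum, Function.comp_def]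
    · right; left
      simp [Gate.eval, map_list_sum, Function.comp_def]
    · exact .inl rfl
    · exact .inr (.inr (.inr hp))
  | mul l =>
    obtain ⟨K, hK, hc⟩ := exists_isLinearization_list_prod hS h hv l
    exact ⟨K, hK, hc.mono subset_rfl
      (by simp only [Gate.fanIn]; nlinarith [Nat.zero_le (t * (1 + l.length))])⟩

theorem Circuit.exists_isLinearization {t : ℕ} (hFs : ∀ i, HasCircuit (Fs i) t) {k : ℕ}
    (c : Circuit F (Fin n ⊕ Fin m) k) :
    ∃ H : Fin k → MvPolynomial (Fin n ⊕ Fin m) F,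
      (∀ o, IsLinearization Fs (c.eval o) (H o)) ∧
      JointlyComputable (⋃ o, linearizationData Fs (c.eval o) (H o)) ((t + 15) * c.size) := by
  induction c with
  | nil =>
    exact ⟨Fin.elim0, fun o => o.elim0, jointlyComputable_empty.mono (by simp) (Nat.zero_le _)⟩
  | @snoc k c g ih =>
    obtain ⟨H, hH, hc⟩ := ih
    obtain ⟨K, hK, hcK⟩ := g.exists_isLinearization hFs hc hH
      (Set.subset_iUnion fun o => linearizationData Fs (c.eval o) (H o))
    refine ⟨Fin.snoc (α := fun _ => _) H K, ?_, ?_⟩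
    · intro o
      induction o using Fin.lastCases with
      | last => simpa [Circuit.eval] using hK
      | cast o => simpa [Circuit.eval] using hH o
    · refine hcK.mono (Set.iUnion_subset fun o => ?_) (mul_add _ _ _).ge
      induction o using Fin.lastCases with
      | last => simp [Circuit.eval]
      | cast o =>
        refine Set.subset_union_of_subset_right (Set.subset_iUnion_of_subset o ?_) _
        simp [Circuit.eval]

/-- Every certificate can be turned into a Hilbert-like one with a quadratic increase of the
circuit size, whatever its degree and its number of terms. -/
theorem IsCertificate.exists_isHilbertLike {C : MvPolynomial (Fin n ⊕ Fin m) F} {s t : ℕ}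
    (hC : IsCertificate Fs C) (hs : HasCircuit C s) (hFs : ∀ i, HasCircuit (Fs i) t) :
    ∃ C' : MvPolynomial (Fin n ⊕ Fin m) F,
      IsCertificate Fs C' ∧ IsHilbertLike C' ∧ HasCircuit C' ((t + 15) * s) := by
  obtain ⟨k, c, o, rfl, hcs⟩ := hs
  obtain ⟨H, hH, hc⟩ := c.exists_isLinearization hFs
  refine ⟨H o, ⟨(hH o).isHilbertLike.substPlaceholders_zero, ?_⟩, (hH o).isHilbertLike, ?_⟩
  · refine (hH o).subst_eq.trans ?_
    rw [show substPlaceholders Fs (c.eval o) = 1 from hC.subst_system,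
      show substPlaceholders 0 (c.eval o) = 0 from hC.subst_zero, sub_zero]
  · exact (hc.mono subset_rfl (Nat.mul_le_mul_left _ hcs)).hasCircuit
      (Set.mem_iUnion.2 ⟨o, .inr (.inr rfl)⟩)

end Linearization

end IPS

theorem mainTheorem10 :
    ∃ P : MvPolynomial (Fin 4) ℕ,
      ∀ (F : Type*) [Field F] (n m : ℕ) (Fs : Fin m → MvPolynomial (Fin n) F)
        (C : MvPolynomial (Fin n ⊕ Fin m) F) (D t s : ℕ),
        IPS.IsCertificate Fs C →
        IPS.maxDegree C = D →
        IPS.numTerms C = t →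
        IPS.HasCircuit C s →
        (∀ i, IPS.HasCircuit (Fs i) s) →
        ∃ C' : MvPolynomial (Fin n ⊕ Fin m) F,
          IPS.IsCertificate Fs C' ∧ IPS.IsHilbertLike C' ∧
            IPS.HasCircuit C' (MvPolynomial.eval ![D, t, n, s] P) := by
  -- The bound `(t + 15) * s` of `IsCertificate.exists_isHilbertLike`, with the circuits of the `Fᵢ`
  -- also of size `s`; `X 3` stands for `s`.
  refine ⟨(MvPolynomial.X 3 + MvPolynomial.C 15) * MvPolynomial.X 3, ?_⟩
  intro F _ n m Fs C D t s hC _ _ hs hFs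
  simpa using hC.exists_isHilbertLike hs hFs
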